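/- **Corollary 1 (NSP of biased subgaussian matrices).** For $x\in\mathbb{R}^N$ and real $q\ge 1$ let $\|x\|_q=(\sum_i|x_i|^q)^{1/q}$. For $v\in\mathbb{R}^n$ and $S\subset\{1,\dots,n\}$ let $v_S$ be the vector that agrees with $v$ on $S$ and is zero off $S$, and let $S^C$ be the complement of $S$. A matrix $A\in\mathbb{R}^{m\times n}$ has the $\ell_q$-robust null space property ($\ell_q$-NSP) of order $s$ with respect to the $\ell_2$-norm, with parameters $\rho\in(0,1)$ and $\tau>0$, if for all $v\in\mathbb{R}^n$ and all $S\subset\{1,\dots,n\}$ with $|S|\le s$ $$\|v_S\|_q\le\frac{\rho}{s^{1-1/q}}\|v_{S^C}\|_1+\tau\|Av\|_2 .$$ Let $m,n,s$ be natural numbers with $1\le s\le n$, let $q\in[2,\infty)$ and $\rho\in(0,1)$, and suppose that $$m\ \ge\ \frac{2\cdot 384^2}{\rho^2}\,s^{2-2/q}\left(2+\sqrt{\log\left(\frac{en}{s}\right)}\right)^2+1 .$$ Then there is $\tau>0$, depending only on $m,n,s,q,\rho$, such that the following holds. Let $a_0$ be a random vector in $\mathbb{R}^n$ that is * sub-isotropic: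 $\mathbb{E}\,\langle a_0,v\rangle^2\ge\|v\|_2^2$ for all $v\in\mathbb{R}^n$, and * $1$-subgaussian: $\mathbb{E}\exp(t\langle a_0,v\rangle)\le\exp(t^2)$ for all $v\in\mathbb{R}^n$ with $\|v\|_2^2\le 1$ and all $t\in\mathbb{R}$, let $a_{0,1},\dots,a_{0,m}$ be independent copies of $a_0$, let $\mu\in\mathbb{R}$, and let $A\in\mathbb{R}^{m\times n}$ be the random matrix with rows $a_i=a_{0,i}+\mu\mathbf{1}$, where $\mathbf{1}=(1,\dots,1)$. Then with probability at least $1-e^{-(m-1)/64}$ the matrix $A$ has the $\ell_q$-NSP of order $s$ with parameters $\rho$ and $\tau$. In particular, neither the condition on $m$ nor $\tau$ depends on the bias $\mu$. -/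

import Mathlib

open MeasureTheory ProbabilityTheory

/-- The `ℓ_q` norm `(∑ |x_i|^q)^(1/q)` of a finite real vector, for a real exponent `q ≥ 1`. -/
noncomputable def lqNorm {ι : Type*} [Fintype ι] (q : ℝ) (x : ι → ℝ) : ℝ :=
  (∑ i, |x i| ^ q) ^ (1 / q)

/-- The `ℓ_q`-robust null space property of order `s` with respect to the `ℓ_2` norm, with
parameters `ρ` and `τ`. The vector `v_S` agrees with `v` on `S` and vanishes off `S`. -/
def RobustNSP {m n : ℕ} (q : ℝ) (s : ℕ) (ρ τ : ℝ) (A : Matrix (Fin m) (Fin n) ℝ) : Prop :=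
  ∀ (v : Fin n → ℝ) (S : Finset (Fin n)), S.card ≤ s →
    lqNorm q (Set.indicator (S : Set (Fin n)) v) ≤
      ρ / (s : ℝ) ^ (1 - 1 / q) * lqNorm 1 (Set.indicator (S : Set (Fin n))ᶜ v)
        + τ * lqNorm 2 (A.mulVec v)

/-- Sub-isotropy of a random vector: `E ⟨X, v⟩² ≥ ‖v‖²` for all `v`. -/
def SubIsotropic {Ω : Type*} [MeasurableSpace Ω] {n : ℕ}
    (X : Ω → EuclideanSpace ℝ (Fin n)) (P : Measure Ω) : Prop :=
  ∀ v : EuclideanSpace ℝ (Fin n),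
    Integrable (fun ω => inner ℝ (X ω) v ^ 2) P ∧ ‖v‖ ^ 2 ≤ ∫ ω, inner ℝ (X ω) v ^ 2 ∂P

/-- A `1`-subgaussian random vector: `E exp (t ⟨X, v⟩) ≤ exp (t²)`, the expectation being finite,
for all `v` in the Euclidean unit ball and all real `t`. -/
def OneSubgaussian {Ω : Type*} [MeasurableSpace Ω] {n : ℕ}
    (X : Ω → EuclideanSpace ℝ (Fin n)) (P : Measure Ω) : Prop :=
  ∀ v : EuclideanSpace ℝ (Fin n), ‖v‖ ^ 2 ≤ 1 → ∀ t : ℝ,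
    Integrable (fun ω => Real.exp (t * inner ℝ (X ω) v)) P ∧
      ∫ ω, Real.exp (t * inner ℝ (X ω) v) ∂P ≤ Real.exp (t ^ 2)

/-- The matrix whose `i`-th row is `a i + μ 1`. -/
def biasedMatrix {m n : ℕ} (a : Fin m → EuclideanSpace ℝ (Fin n)) (μ : ℝ) :
    Matrix (Fin m) (Fin n) ℝ :=
  Matrix.of fun i j => a i j + μ

/-! Pair the rows and take normalized differences. A common shift `μ 1` cancels, so `μ` disappears
from the problem; the `M = m / 2` differences are again independent and subgaussian with the same
parameter, and sub-isotropic because subgaussian variables are centred. Since `(x - y)² / 2 ≤ x² +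
y²`, a lower bound for the matrix of differences is one for `A` (`norm_rowMap_pairDiff_le`).

Put `L = s ^ (1 - 1/q) / ρ`. A vector violating the null space inequality without its `τ` term
satisfies `‖v‖₁ ≤ 2 L ‖v‖₂`, so a lower bound on this cone suffices (`robustNSP_of_lower_bound`).

On the cone, `v / ‖v‖₁` is a convex combination of signed basis vectors. Maurey's method replaces it
by an average of about `625 L²` of them, with an error small both in `‖·‖₂` and in the image under
the matrix; the latter only needs bounded columns (`norm_rowMap_ge`). There remain finitely many
vectors, about `exp (C L² log (e n / s))`, and a union bound: at each one the lower tail of a sum of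
squares is exponentially small, by `E exp (-X²/4) ≤ exp (-1/20)`, while `E exp (X²/8) ≤ √2` controls
the columns. -/

/-! ### Maurey's empirical method and the size of the net -/

/-- One averaging step: moving a point by `x i - w` with `i` chosen according to weights of
barycentre `w` increases the mean square norm by at most `B`. -/
theorem exists_norm_add_sub_sq_le {ι F : Type*} [Fintype ι] [NormedAddCommGroup F]
    [InnerProductSpace ℝ F] (p : ι → ℝ) (hp : ∀ i, 0 ≤ p i) (hp1 : ∑ i, p i = 1) (x : ι → F)
    {B : ℝ} (hB : ∀ i, ‖x i‖ ^ 2 ≤ B) (z : F) :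
    ∃ i, ‖z + (x i - ∑ j, p j • x j)‖ ^ 2 ≤ ‖z‖ ^ 2 + B := by
  set w := ∑ j, p j • x j with hw
  by_contra! h
  -- The weighted mean equals `‖z‖² - ‖w‖² + ∑ p i ‖x i‖²`, so not every term can exceed `‖z‖² + B`.
  have hsum : ∑ i, p i * ‖z + (x i - w)‖ ^ 2 ≤ ‖z‖ ^ 2 + B := by
    have h1 : ∀ i, p i * ‖z + (x i - w)‖ ^ 2
        = p i * ‖z - w‖ ^ 2 + 2 * inner ℝ (z - w) (p i • x i) + p i * ‖x i‖ ^ 2 := by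
      intro i
      rw [show z + (x i - w) = (z - w) + x i by abel, norm_add_sq_real, inner_smul_right]
      ring
    simp_rw [h1]
    rw [Finset.sum_add_distrib, Finset.sum_add_distrib, ← Finset.sum_mul, hp1, ← Finset.mul_sum,
      ← inner_sum, ← hw]
    have h2 : ∑ i, p i * ‖x i‖ ^ 2 ≤ B := by
      calc ∑ i, p i * ‖x i‖ ^ 2 ≤ ∑ i, p i * B :=
            Finset.sum_le_sum fun i _ => mul_le_mul_of_nonneg_left (hB i) (hp i)
        _ = B := by rw [← Finset.sum_mul, hp1, one_mul]
    have h3 : 1 * ‖z - w‖ ^ 2 + 2 * inner ℝ (z - w) w = ‖z‖ ^ 2 - ‖w‖ ^ 2 := by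
      rw [norm_sub_sq_real, inner_sub_left, real_inner_self_eq_norm_sq]
      ring
    nlinarith [sq_nonneg ‖w‖]
  obtain ⟨i, hi⟩ : ∃ i, 0 < p i := by
    by_contra! h0
    have : ∑ i, p i ≤ 0 := Finset.sum_nonpos fun i _ => h0 i
    linarith
  have hlt : ∑ i, p i * (‖z‖ ^ 2 + B) < ∑ i, p i * ‖z + (x i - w)‖ ^ 2 :=
    Finset.sum_lt_sum (fun j _ => mul_le_mul_of_nonneg_left (h j).le (hp j))
      ⟨i, Finset.mem_univ i, mul_lt_mul_of_pos_left (h i) hi⟩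
  rw [← Finset.sum_mul, hp1, one_mul] at hlt
  linarith

/-- **Maurey's empirical method**: a convex combination of vectors whose images under `Φ` have
square norm at most `B` is approximated, in the seminorm `‖Φ ·‖`, by sums over multisets. -/
theorem exists_sym_sum_approx {ι E F : Type*} [Fintype ι] [AddCommGroup E] [Module ℝ E]
    [NormedAddCommGroup F] [InnerProductSpace ℝ F] (Φ : E →ₗ[ℝ] F)
    (p : ι → ℝ) (hp : ∀ i, 0 ≤ p i) (hp1 : ∑ i, p i = 1) (f : ι → E)
    {B : ℝ} (hB : ∀ i, ‖Φ (f i)‖ ^ 2 ≤ B) (k : ℕ) :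
    ∃ σ : Sym ι k,
      ‖Φ (((σ : Multiset ι).map f).sum - (k : ℝ) • ∑ i, p i • f i)‖ ^ 2 ≤ k * B := by
  induction k with
  | zero => exact ⟨Sym.nil, by simp⟩
  | succ k ih =>
    obtain ⟨σ, hσ⟩ := ih
    obtain ⟨i, hi⟩ := exists_norm_add_sub_sq_le p hp hp1 (fun i => Φ (f i)) hB
      (Φ (((σ : Multiset ι).map f).sum - (k : ℝ) • ∑ i, p i • f i))
    refine ⟨i ::ₛ σ, ?_⟩
    have heq : Φ ((((i ::ₛ σ : Sym ι (k + 1)) : Multiset ι).map f).sum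
        - ((k + 1 : ℕ) : ℝ) • ∑ i, p i • f i)
        = Φ (((σ : Multiset ι).map f).sum - (k : ℝ) • ∑ i, p i • f i)
          + (Φ (f i) - ∑ j, p j • Φ (f j)) := by
      simp only [Sym.coe_cons, Multiset.map_cons, Multiset.sum_cons, map_sub, map_add, map_smul,
        map_sum, Nat.cast_add, Nat.cast_one, add_smul, one_smul]
      abel
    rw [heq]
    push_cast
    linarith

/-- The number of multisets of size `k` in a set of size `N` is at most `(e (N + k) / k) ^ k`. -/
theorem card_sym_le_exp {ι : Type*} [Fintype ι] [DecidableEq ι] {k : ℕ} (hk : 0 < k) :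
    (Fintype.card (Sym ι k) : ℝ)
      ≤ Real.exp (k * (1 + Real.log ((Fintype.card ι + k) / k))) := by
  have hk' : (0 : ℝ) < k := by exact_mod_cast hk
  set N := Fintype.card ι
  have h1 : (Fintype.card (Sym ι k) : ℝ) ≤ (N + k : ℝ) ^ k / k.factorial := by
    rw [Sym.card_sym_eq_choose]
    refine (Nat.choose_le_pow_div (α := ℝ) k _).trans ?_
    gcongr
    exact_mod_cast Nat.sub_le _ _
  have h2 : (k : ℝ) ^ k / k.factorial ≤ Real.exp k := Real.pow_div_factorial_le_exp _ hk'.le k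
  have h3 : (N + k : ℝ) ^ k / k.factorial = ((N + k) / k) ^ k * ((k : ℝ) ^ k / k.factorial) := by
    rw [div_pow]
    field_simp
  have hpos : (0 : ℝ) < (N + k) / k := by positivity
  rw [mul_add, mul_one, Real.exp_add, mul_comm (k : ℝ) (Real.log _), Real.exp_mul,
    Real.exp_log hpos, Real.rpow_natCast, mul_comm]
  refine h1.trans (h3.le.trans ?_)
  gcongr

/-! ### Deterministic lower bound on the cone -/

/-- The signed standard basis of `ℝⁿ`. -/
noncomputable def signedBasis {n : ℕ} (i : Fin n × Bool) : EuclideanSpace ℝ (Fin n) :=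
  EuclideanSpace.single i.1 (if i.2 then 1 else -1)

/-- The weights that write `w` as a combination of the signed standard basis. -/
def signedWeight {n : ℕ} (w : EuclideanSpace ℝ (Fin n)) (i : Fin n × Bool) : ℝ :=
  if i.2 then max (w i.1) 0 else max (-w i.1) 0

theorem signedWeight_nonneg {n : ℕ} (w : EuclideanSpace ℝ (Fin n)) (i : Fin n × Bool) :
    0 ≤ signedWeight w i := by
  unfold signedWeight
  split_ifs <;> exact le_max_right _ _

theorem sum_signedWeight {n : ℕ} (w : EuclideanSpace ℝ (Fin n)) :
    ∑ i, signedWeight w i = ∑ j, |w j| := by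
  rw [Fintype.sum_prod_type]
  refine Finset.sum_congr rfl fun j _ => ?_
  simp only [Fintype.sum_bool, signedWeight, if_true, Bool.false_eq_true, if_false]
  rcases le_total 0 (w j) with h | h
  · rw [max_eq_left h, max_eq_right (by linarith), abs_of_nonneg h, add_zero]
  · rw [max_eq_right h, max_eq_left (by linarith), abs_of_nonpos h, zero_add]

theorem sum_signedWeight_smul {n : ℕ} (w : EuclideanSpace ℝ (Fin n)) :
    ∑ i, signedWeight w i • signedBasis i = w := by
  ext l
  rw [Fintype.sum_prod_type]
  simp only [Fintype.sum_bool, signedWeight, signedBasis, if_true, Bool.false_eq_true, if_false,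
    WithLp.ofLp_sum, WithLp.ofLp_add, WithLp.ofLp_smul, Finset.sum_apply, Pi.add_apply,
    Pi.smul_apply, smul_eq_mul, PiLp.single_apply]
  rw [Finset.sum_eq_single l (fun j _ hj => by simp [hj.symm]) (by simp)]
  simp only [if_true, mul_one, mul_neg]
  rcases le_total 0 (w l) with h | h
  · rw [max_eq_left h, max_eq_right (by linarith)]; ring
  · rw [max_eq_right h, max_eq_left (by linarith)]; ring

/-- The linear map `v ↦ (⟨d i, v⟩)ᵢ`. -/
noncomputable def rowMap {M n : ℕ} (d : Fin M → EuclideanSpace ℝ (Fin n)) :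
    EuclideanSpace ℝ (Fin n) →ₗ[ℝ] EuclideanSpace ℝ (Fin M) where
  toFun v := WithLp.toLp 2 fun i => inner ℝ (d i) v
  map_add' u v := by ext i; simp [inner_add_right]
  map_smul' c v := by ext i; simp [inner_smul_right]

theorem norm_rowMap_sq {M n : ℕ} (d : Fin M → EuclideanSpace ℝ (Fin n))
    (v : EuclideanSpace ℝ (Fin n)) : ‖rowMap d v‖ ^ 2 = ∑ i, inner ℝ (d i) v ^ 2 := by
  rw [EuclideanSpace.real_norm_sq_eq]
  rfl

/-- If the columns of `d` are bounded and `d` is bounded below on all sums of `k` signed basis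
vectors, then `d` is bounded below on all `v` with `‖v‖₁ ≤ 2 L ‖v‖₂`. -/
theorem norm_rowMap_ge {M n k : ℕ} (hM : 0 < M) (d : Fin M → EuclideanSpace ℝ (Fin n)) {L : ℝ}
    (hL : 0 < L) (hk : 625 * L ^ 2 ≤ k)
    (hcol : ∀ j, ∑ i, d i j ^ 2 ≤ 4 * M)
    (hnet : ∀ σ : Sym (Fin n × Bool) k,
      M / 25 * ‖((σ : Multiset (Fin n × Bool)).map signedBasis).sum‖ ^ 2
        ≤ ‖rowMap d ((σ : Multiset (Fin n × Bool)).map signedBasis).sum‖ ^ 2)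
    (v : EuclideanSpace ℝ (Fin n)) (hv : ∑ j, |v j| ≤ 2 * L * ‖v‖) :
    3 / 125 * Real.sqrt M * ‖v‖ ≤ ‖rowMap d v‖ := by
  by_cases hv0 : v = 0
  · simp [hv0]
  have hM' : (0 : ℝ) < M := by exact_mod_cast hM
  have hkp : (0 : ℝ) < k := lt_of_lt_of_le (by positivity) hk
  set r := ∑ j, |v j| with hr
  have hnv : 0 < ‖v‖ := norm_pos_iff.2 hv0
  have hr0 : 0 < r := by
    obtain ⟨j, hj⟩ : ∃ j, v j ≠ 0 := by
      by_contra! h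
      exact hv0 (by ext j; simpa using h j)
    exact Finset.sum_pos' (fun j _ => abs_nonneg _) ⟨j, Finset.mem_univ j, abs_pos.2 hj⟩
  set R := Real.sqrt M with hR
  have hR0 : 0 < R := Real.sqrt_pos.2 hM'
  have hR2 : R ^ 2 = M := Real.sq_sqrt hM'.le
  set w := r⁻¹ • v with hw
  have hw1 : ∑ j, |w j| = 1 := by
    simp only [hw, PiLp.smul_apply, smul_eq_mul, abs_mul, abs_of_pos (inv_pos.2 hr0)]
    rw [← Finset.mul_sum, ← hr, inv_mul_cancel₀ hr0.ne']
  have hwn : 1 ≤ 2 * L * ‖w‖ := by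
    rw [hw, norm_smul, Real.norm_of_nonneg (inv_pos.2 hr0).le]
    field_simp
    linarith
  -- the Hilbert norm `2/5 ‖x‖² + ‖d x‖² / M`
  let Φ : EuclideanSpace ℝ (Fin n) →ₗ[ℝ]
      WithLp 2 (EuclideanSpace ℝ (Fin n) × EuclideanSpace ℝ (Fin M)) :=
    (WithLp.linearEquiv 2 ℝ _).symm.toLinearMap ∘ₗ
      LinearMap.prod (Real.sqrt (2 / 5) • LinearMap.id) (R⁻¹ • rowMap d)
  have hΦ : ∀ x, ‖Φ x‖ ^ 2 = 2 / 5 * ‖x‖ ^ 2 + ‖rowMap d x‖ ^ 2 / M := by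
    intro x
    rw [WithLp.prod_norm_sq_eq_of_L2]
    have e1 : (Φ x).fst = Real.sqrt (2 / 5) • x := rfl
    have e2 : (Φ x).snd = R⁻¹ • rowMap d x := rfl
    rw [e1, e2, norm_smul, norm_smul, mul_pow, mul_pow, Real.norm_of_nonneg (Real.sqrt_nonneg _),
      Real.sq_sqrt (by norm_num), Real.norm_of_nonneg (inv_pos.2 hR0).le, inv_pow, hR2]
    ring
  have hB : ∀ i, ‖Φ (signedBasis i)‖ ^ 2 ≤ 22 / 5 := by
    rintro ⟨j, b⟩
    rw [hΦ, norm_rowMap_sq]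
    have e1 : ‖(signedBasis (j, b) : EuclideanSpace ℝ (Fin n))‖ ^ 2 = 1 := by
      cases b <;> simp [signedBasis]
    have e2 : ∀ i, inner ℝ (d i) (signedBasis (j, b)) ^ 2 = d i j ^ 2 := by
      intro i
      cases b <;> simp [signedBasis, EuclideanSpace.inner_single_right]
    simp_rw [e1, e2]
    have : (∑ i, d i j ^ 2) / M ≤ 4 := by
      rw [div_le_iff₀ hM']
      exact hcol j
    linarith
  obtain ⟨σ, hσ⟩ := exists_sym_sum_approx Φ (signedWeight w) (signedWeight_nonneg w)
    (by rw [sum_signedWeight, hw1]) signedBasis hB k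
  rw [sum_signedWeight_smul, hΦ] at hσ
  have hn := hnet σ
  set y := ((σ : Multiset (Fin n × Bool)).map signedBasis).sum with hy
  set x := y - (k : ℝ) • w with hx
  have hyx : y = (k : ℝ) • w + x := by rw [hx]; abel
  -- lower bound for `‖d y‖`
  have h1 : R / 5 * ‖y‖ ≤ ‖rowMap d y‖ := by
    refine le_of_sq_le_sq ?_ (norm_nonneg _)
    calc (R / 5 * ‖y‖) ^ 2 = R ^ 2 / 25 * ‖y‖ ^ 2 := by ring
      _ ≤ _ := by rw [hR2]; exact hn
  have h2 : (k : ℝ) * ‖w‖ - ‖x‖ ≤ ‖y‖ := by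
    have : (k : ℝ) • w = y - x := by rw [hx]; abel
    have h := norm_sub_le y x
    rw [← this, norm_smul, Real.norm_of_nonneg hkp.le] at h
    linarith
  have h3 : ‖rowMap d y‖ ≤ k * ‖rowMap d w‖ + ‖rowMap d x‖ := by
    rw [hyx, map_add, map_smul]
    refine (norm_add_le _ _).trans ?_
    rw [norm_smul, Real.norm_of_nonneg hkp.le]
  -- This is the loss in passing from `y` to `k • w`. Cauchy–Schwarz with weights `1` and `2/5`
  -- costs `1 + (1/25)/(2/5) = 11/10`; then `√(11/10 · 22/5) = 11/5` is divided by `25 L`. Since `k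
  -- / L ≤ 2 k ‖w‖` on the cone, `1/5 - 22/125 = 3/125` survives.
  have h4 : ‖rowMap d x‖ / R + ‖x‖ / 5 ≤ 11 / 125 * (k / L) := by
    refine le_of_sq_le_sq ?_ (by positivity)
    have e : ‖rowMap d x‖ ^ 2 / M = (‖rowMap d x‖ / R) ^ 2 := by rw [div_pow, hR2]
    rw [e] at hσ
    have hc : (‖rowMap d x‖ / R + ‖x‖ / 5) ^ 2
        ≤ 11 / 10 * (2 / 5 * ‖x‖ ^ 2 + (‖rowMap d x‖ / R) ^ 2) := by
      nlinarith [sq_nonneg (‖rowMap d x‖ / R - 2 * ‖x‖)]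
    have hkL : (k : ℝ) ≤ k ^ 2 / (625 * L ^ 2) := by
      rw [le_div_iff₀ (by positivity), sq (k : ℝ)]
      exact mul_le_mul_of_nonneg_left hk hkp.le
    calc (‖rowMap d x‖ / R + ‖x‖ / 5) ^ 2 ≤ 11 / 10 * ((k : ℝ) * (22 / 5)) := hc.trans (by linarith)
      _ ≤ 11 / 10 * ((k : ℝ) ^ 2 / (625 * L ^ 2) * (22 / 5)) := by gcongr
      _ = _ := by ring
  have h5 : k / L ≤ 2 * (k * ‖w‖) := by
    rw [div_le_iff₀ hL]
    nlinarith
  have h6 : ‖rowMap d x‖ + R * ‖x‖ / 5 = R * (‖rowMap d x‖ / R + ‖x‖ / 5) := by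
    field_simp
  have h7 : R * (‖rowMap d x‖ / R + ‖x‖ / 5) ≤ R * (22 / 125 * (k * ‖w‖)) :=
    mul_le_mul_of_nonneg_left (by linarith) hR0.le
  have h8 : R / 5 * (k * ‖w‖ - ‖x‖) ≤ R / 5 * ‖y‖ := mul_le_mul_of_nonneg_left h2 (by positivity)
  have h9 : k * (3 / 125 * R * ‖w‖) ≤ k * ‖rowMap d w‖ := by nlinarith
  have h10 : 3 / 125 * R * ‖w‖ ≤ ‖rowMap d w‖ := le_of_mul_le_mul_left h9 hkp
  rw [hw, map_smul, norm_smul, norm_smul, Real.norm_of_nonneg (inv_pos.2 hr0).le] at h10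
  refine le_of_mul_le_mul_left ?_ (inv_pos.2 hr0)
  linarith

/-! ### Exponential moments of squares of subgaussian variables -/

theorem add_pow_four_add_pow_six_le_cosh (x : ℝ) :
    1 + x ^ 2 + x ^ 4 / 6 + x ^ 6 / 90 ≤ Real.cosh (Real.sqrt 2 * x) := by
  have h := sum_le_hasSum (Finset.range 4) (fun i _ => by
    have : 0 ≤ (Real.sqrt 2 * x) ^ (2 * i) := by rw [pow_mul]; positivity
    positivity) (Real.hasSum_cosh (Real.sqrt 2 * x))
  refine le_trans (le_of_eq ?_) h
  simp only [Finset.sum_range_succ, Finset.sum_range_zero, pow_mul, mul_pow,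
    Real.sq_sqrt (show (0 : ℝ) ≤ 2 by norm_num)]
  simp only [Nat.factorial]
  norm_num
  ring

/-- With `y = x²` the bracket is at most `cosh (√2 x) - 1`. The coefficients are tuned for
`integral_exp_neg_sq_le`. -/
theorem exp_neg_div_four_le {y : ℝ} (hy : 0 ≤ y) :
    Real.exp (-(y / 4)) ≤ 1 - 81 / 1000 * y + 48 / 10000 * (y + y ^ 2 / 6 + y ^ 3 / 90) := by
  have h1 : Real.exp (-(y / 4)) ≤ 4 / (4 + y) := by
    rw [Real.exp_neg, inv_le_comm₀ (Real.exp_pos _) (by positivity), inv_div]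
    linarith [Real.add_one_le_exp (y / 4)]
  refine h1.trans ?_
  rw [div_le_iff₀ (by positivity)]
  nlinarith [mul_nonneg hy (sq_nonneg (y - 16)), mul_nonneg (mul_nonneg hy hy) (sq_nonneg (y - 16))]

theorem lintegral_exp_sq_gaussianReal :
    ∫⁻ g, ENNReal.ofReal (Real.exp (g ^ 2 / 4)) ∂(gaussianReal 0 1)
      = ENNReal.ofReal (Real.sqrt 2) := by
  rw [gaussianReal_of_var_ne_zero 0 one_ne_zero,
    lintegral_withDensity_eq_lintegral_mul _ (by fun_prop) (by fun_prop)]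
  have h : ∀ g : ℝ, (gaussianPDF 0 1 * fun g => ENNReal.ofReal (Real.exp (g ^ 2 / 4))) g
      = ENNReal.ofReal ((Real.sqrt (2 * Real.pi))⁻¹ * Real.exp (-(1 / 4) * g ^ 2)) := by
    intro g
    rw [Pi.mul_apply, gaussianPDF, ← ENNReal.ofReal_mul (gaussianPDFReal_nonneg _ _ _),
      gaussianPDFReal, mul_assoc, ← Real.exp_add]
    congr 3
    · simp
    · simp only [NNReal.coe_one]
      ring_nf
  simp_rw [h]
  rw [← ofReal_integral_eq_lintegral_ofReal
    ((integrable_exp_neg_mul_sq (by norm_num)).const_mul _) (ae_of_all _ fun g => by positivity),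
    integral_const_mul, integral_gaussian]
  congr 1
  rw [inv_mul_eq_div, ← Real.sqrt_div' _ (by positivity)]
  congr 1
  have := Real.pi_pos.ne'
  field_simp
  norm_num

namespace ProbabilityTheory.HasSubgaussianMGF

variable {Ω : Type*} [MeasurableSpace Ω] {P : Measure Ω} [IsProbabilityMeasure P] {X : Ω → ℝ}

/-- To first order in `t`, `1 + t E Y ≤ E exp (t Y) ≤ 1 + c t²`; letting `t` be small gives `E Y ≤
0`, and the same holds for `-Y`. -/
theorem integral_eq_zero {c : NNReal} (h : HasSubgaussianMGF X c P) : ∫ ω, X ω ∂P = 0 := by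
  have key : ∀ {Y : Ω → ℝ}, HasSubgaussianMGF Y c P → ∫ ω, Y ω ∂P ≤ 0 := by
    intro Y hY
    have h1 : ∀ t : ℝ, 0 < t → c * t ^ 2 ≤ 1 → ∫ ω, Y ω ∂P ≤ c * t := by
      intro t ht htc
      have h2 : 1 + t * ∫ ω, Y ω ∂P ≤ Real.exp (c * t ^ 2 / 2) := by
        refine le_trans ?_ (hY.mgf_le t)
        have : 1 + t * ∫ ω, Y ω ∂P = ∫ ω, (1 + t * Y ω) ∂P := by
          rw [integral_add (integrable_const _) (hY.integrable.const_mul t), integral_const_mul]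
          simp
        rw [this, mgf]
        refine integral_mono ((integrable_const _).add (hY.integrable.const_mul t))
          (hY.integrable_exp_mul t) fun ω => ?_
        have := Real.add_one_le_exp (t * Y ω)
        simp only
        linarith
      have h3 : Real.exp (c * t ^ 2 / 2) ≤ 1 + c * t ^ 2 := by
        have hu : 0 ≤ c * t ^ 2 / 2 := by positivity
        have := Real.abs_exp_sub_one_le (x := c * t ^ 2 / 2) (by rw [abs_of_nonneg hu]; linarith)
        rw [abs_of_nonneg hu] at this
        linarith [le_abs_self (Real.exp (c * t ^ 2 / 2) - 1)]
      have h4 : t * ∫ ω, Y ω ∂P ≤ t * (c * t) := by nlinarith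
      exact le_of_mul_le_mul_left h4 ht
    by_contra! hpos
    set e := ∫ ω, Y ω ∂P
    have hc0 : (0 : ℝ) ≤ c := c.2
    set t := min (e / (2 * (c + 1))) (1 / (c + 1)) with ht
    have ht0 : 0 < t := lt_min (by positivity) (by positivity)
    have ht1 : t * (c + 1) ≤ 1 := by
      have : t ≤ 1 / (c + 1) := min_le_right _ _
      rwa [le_div_iff₀ (by positivity)] at this
    have ht2 : t * (2 * (c + 1)) ≤ e := by
      have : t ≤ e / (2 * (c + 1)) := min_le_left _ _
      rwa [le_div_iff₀ (by positivity)] at this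
    have := h1 t ht0 (by nlinarith [mul_nonneg hc0 ht0.le])
    nlinarith [mul_nonneg hc0 ht0.le]
  refine le_antisymm (key h) ?_
  have := key h.neg
  simp only [Pi.neg_apply, integral_neg] at this
  linarith

/-- The integrand is majorized by a decreasing affine function of `X²` plus a small multiple of
`cosh (√2 X)`. The second moment handles the former, and the mgf at `±√2` gives `E cosh ≤ e²`.
Numerically `0.9142 + 0.0048 · 7.39 < 1 - 1/20`. -/
theorem integral_exp_neg_sq_le (h : HasSubgaussianMGF X 2 P) (h2 : 1 ≤ ∫ ω, X ω ^ 2 ∂P) :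
    ∫ ω, Real.exp (-(1 / 4) * X ω ^ 2) ∂P ≤ Real.exp (-(1 / 20)) := by
  have hX2 : Integrable (fun ω => X ω ^ 2) P := (h.memLp 2).integrable_sq
  set a := Real.sqrt 2
  have ha : a ^ 2 = 2 := Real.sq_sqrt (by norm_num)
  have hI1 := h.integrable_exp_mul a
  have hI2 := h.integrable_exp_mul (-a)
  have hcosh : Integrable (fun ω => Real.cosh (a * X ω)) P := by
    refine ((hI1.add hI2).div_const 2).congr (ae_of_all _ fun ω => ?_)
    simp [Real.cosh_eq]
  have hcoshle : ∫ ω, Real.cosh (a * X ω) ∂P ≤ Real.exp 2 := by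
    have e : ∫ ω, Real.cosh (a * X ω) ∂P = (mgf X P a + mgf X P (-a)) / 2 := by
      rw [mgf, mgf, ← integral_add hI1 hI2, ← integral_div]
      refine integral_congr_ae (ae_of_all _ fun ω => ?_)
      simp [Real.cosh_eq]
    have e1 := h.mgf_le a
    have e2 := h.mgf_le (-a)
    rw [neg_sq] at e2
    rw [ha] at e1 e2
    norm_num at e1 e2
    rw [e]
    linarith
  have hpt : ∀ ω, Real.exp (-(1 / 4) * X ω ^ 2)
      ≤ (1 - 48 / 10000) - 81 / 1000 * X ω ^ 2 + 48 / 10000 * Real.cosh (a * X ω) := by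
    intro ω
    have e1 := exp_neg_div_four_le (sq_nonneg (X ω))
    have e2 := add_pow_four_add_pow_six_le_cosh (X ω)
    rw [show -(1 / 4) * X ω ^ 2 = -(X ω ^ 2 / 4) by ring]
    refine e1.trans ?_
    have e3 : (X ω ^ 2) ^ 2 = X ω ^ 4 := by ring
    have e4 : (X ω ^ 2) ^ 3 = X ω ^ 6 := by ring
    rw [e3, e4]
    linarith
  have hint : Integrable (fun ω => (1 - 48 / 10000 : ℝ) - 81 / 1000 * X ω ^ 2
      + 48 / 10000 * Real.cosh (a * X ω)) P :=
    ((integrable_const _).sub (hX2.const_mul _)).add (hcosh.const_mul _)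
  have hle : ∫ ω, Real.exp (-(1 / 4) * X ω ^ 2) ∂P ≤
      ∫ ω, ((1 - 48 / 10000 : ℝ) - 81 / 1000 * X ω ^ 2 + 48 / 10000 * Real.cosh (a * X ω)) ∂P :=
    integral_mono_of_nonneg (ae_of_all _ fun ω => (Real.exp_pos _).le) hint (ae_of_all _ hpt)
  have hI3 : Integrable (fun ω => (1 - 48 / 10000 : ℝ) - 81 / 1000 * X ω ^ 2) P :=
    (integrable_const _).sub (hX2.const_mul _)
  rw [integral_add hI3 (hcosh.const_mul _), integral_sub (integrable_const _) (hX2.const_mul _),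
    integral_const_mul, integral_const_mul] at hle
  simp only [integral_const, probReal_univ, one_smul] at hle
  have he : Real.exp 2 ≤ 7.39 := by
    have := Real.exp_one_lt_d9
    have h0 := Real.exp_pos 1
    rw [show (2 : ℝ) = 1 + 1 by norm_num, Real.exp_add]
    nlinarith
  have := Real.add_one_le_exp (-(1 / 20) : ℝ)
  linarith

/-- Gaussian linearization: `exp (x²/8)` is the mean of `exp (g x / 2)` over a standard Gaussian
`g`. After Tonelli the inner mean is at most `exp (g²/4)`, which has Gaussian mean `√2`. Working
with `∫⁻` makes integrability part of the conclusion. -/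
theorem integral_exp_sq_le (h : HasSubgaussianMGF X 2 P) :
    Integrable (fun ω => Real.exp (1 / 8 * X ω ^ 2)) P ∧
      ∫ ω, Real.exp (1 / 8 * X ω ^ 2) ∂P ≤ Real.sqrt 2 := by
  have hX := h.aemeasurable
  have hm : AEStronglyMeasurable (fun ω => Real.exp (1 / 8 * X ω ^ 2)) P :=
    ((hX.pow_const 2).const_mul _).exp.aestronglyMeasurable
  have hle : ∫⁻ ω, ENNReal.ofReal (Real.exp (1 / 8 * X ω ^ 2)) ∂P
      ≤ ENNReal.ofReal (Real.sqrt 2) := by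
    have e1 : ∀ ω, ENNReal.ofReal (Real.exp (1 / 8 * X ω ^ 2))
        = ∫⁻ g, ENNReal.ofReal (Real.exp (g / 2 * X ω)) ∂(gaussianReal 0 1) := by
      intro ω
      have e2 : ∀ g : ℝ, Real.exp (g / 2 * X ω) = Real.exp (X ω / 2 * g) := fun g => by ring_nf
      simp_rw [e2]
      rw [← ofReal_integral_eq_lintegral_ofReal (integrable_exp_mul_gaussianReal _)
        (ae_of_all _ fun g => (Real.exp_pos _).le)]
      have := congrFun (mgf_fun_id_gaussianReal (μ := 0) (v := 1)) (X ω / 2)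
      rw [mgf] at this
      rw [this]
      congr 2
      simp only [NNReal.coe_one]
      ring
    simp_rw [e1]
    rw [lintegral_lintegral_swap]
    · rw [← lintegral_exp_sq_gaussianReal]
      refine lintegral_mono fun g => ?_
      rw [← ofReal_integral_eq_lintegral_ofReal (h.integrable_exp_mul (g / 2))
        (ae_of_all _ fun ω => (Real.exp_pos _).le)]
      refine ENNReal.ofReal_le_ofReal ((h.mgf_le (g / 2)).trans (le_of_eq ?_))
      congr 1
      simp only [NNReal.coe_ofNat]
      ring
    · have h1 : AEMeasurable (fun z : Ω × ℝ => X z.1) (P.prod (gaussianReal 0 1)) := hX.comp_fst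
      have h2 : AEMeasurable (fun z : Ω × ℝ => z.2 / 2) (P.prod (gaussianReal 0 1)) := by fun_prop
      exact (h2.mul h1).exp.ennreal_ofReal
  have hint : Integrable (fun ω => Real.exp (1 / 8 * X ω ^ 2)) P :=
    ⟨hm, by
      rw [hasFiniteIntegral_iff_ofReal (ae_of_all _ fun ω => (Real.exp_pos _).le)]
      exact hle.trans_lt ENNReal.ofReal_lt_top⟩
  refine ⟨hint, ?_⟩
  rw [← ofReal_integral_eq_lintegral_ofReal hint (ae_of_all _ fun ω => (Real.exp_pos _).le)] at hle
  exact (ENNReal.ofReal_le_ofReal_iff (Real.sqrt_nonneg 2)).1 hle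

end ProbabilityTheory.HasSubgaussianMGF

/-! ### Tail bounds and the union bound -/

/-- Lower tail of a sum of squares of independent subgaussian variables of second moment at
least `1`. -/
theorem measureReal_sum_sq_le_le {Ω : Type*} [MeasurableSpace Ω] {P : Measure Ω}
    [IsProbabilityMeasure P] {M : ℕ} {X : Fin M → Ω → ℝ} (hind : iIndepFun X P)
    (hsub : ∀ i, HasSubgaussianMGF (X i) 2 P) (h2 : ∀ i, 1 ≤ ∫ ω, X i ω ^ 2 ∂P) :
    P.real {ω | ∑ i, X i ω ^ 2 ≤ (M : ℝ) / 25} ≤ Real.exp (-(M / 25 : ℝ)) := by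
  have hind2 : iIndepFun (fun i ω => X i ω ^ 2) P :=
    hind.comp (fun _ x => x ^ 2) fun _ => by fun_prop
  have hmeas : ∀ i, AEMeasurable (fun ω => X i ω ^ 2) P :=
    fun i => (hsub i).aemeasurable.pow_const 2
  have hmgf : mgf (∑ i, fun ω => X i ω ^ 2) P (-(1 / 4)) ≤ Real.exp (-(M / 20 : ℝ)) := by
    rw [hind2.mgf_sum₀ hmeas]
    calc ∏ i, mgf (fun ω => X i ω ^ 2) P (-(1 / 4)) ≤ ∏ _i : Fin M, Real.exp (-(1 / 20)) :=
          Finset.prod_le_prod (fun i _ => mgf_nonneg) fun i _ =>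
            (hsub i).integral_exp_neg_sq_le (h2 i)
      _ = Real.exp (-(M / 20 : ℝ)) := by
          rw [Finset.prod_const, Finset.card_univ, Fintype.card_fin, ← Real.exp_nat_mul]
          ring_nf
  have hint : Integrable (fun ω => Real.exp (-(1 / 4) * (∑ i, fun ω => X i ω ^ 2) ω)) P := by
    refine Integrable.of_bound (C := 1) ?_ (ae_of_all _ fun ω => ?_)
    · exact (((Finset.univ.aemeasurable_sum fun i _ => hmeas i).const_mul _).exp).aestronglyMeasurable
    · rw [Real.norm_of_nonneg (Real.exp_pos _).le, Real.exp_le_one_iff, Finset.sum_apply]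
      have : 0 ≤ ∑ i, X i ω ^ 2 := Finset.sum_nonneg fun i _ => sq_nonneg _
      linarith
  -- Chernoff at `-1/4`: the exponent is `M/100 - M/20 = -M/25`.
  have h := measure_le_le_exp_mul_mgf (μ := P) (M / 25 : ℝ) (by norm_num) hint
  simp only [Finset.sum_apply] at h
  refine h.trans ((mul_le_mul_of_nonneg_left hmgf (Real.exp_pos _).le).trans ?_)
  rw [← Real.exp_add]
  apply le_of_eq
  ring_nf

/-- Upper tail of a sum of squares of independent subgaussian variables. -/
theorem measureReal_le_sum_sq_le {Ω : Type*} [MeasurableSpace Ω] {P : Measure Ω}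
    [IsProbabilityMeasure P] {M : ℕ} {X : Fin M → Ω → ℝ} (hind : iIndepFun X P)
    (hsub : ∀ i, HasSubgaussianMGF (X i) 2 P) :
    P.real {ω | 4 * (M : ℝ) ≤ ∑ i, X i ω ^ 2} ≤ Real.exp (-(3 / 20 * M : ℝ)) := by
  have hind2 : iIndepFun (fun i ω => X i ω ^ 2) P :=
    hind.comp (fun _ x => x ^ 2) fun _ => by fun_prop
  have hmeas : ∀ i, AEMeasurable (fun ω => X i ω ^ 2) P :=
    fun i => (hsub i).aemeasurable.pow_const 2
  have hsum := hind2.mgf_sum₀ (t := 1 / 8) hmeas Finset.univ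
  have hsqrt : Real.sqrt 2 ≤ Real.exp (7 / 20) := by
    rw [Real.sqrt_le_left (Real.exp_pos _).le, sq, ← Real.exp_add]
    calc (2 : ℝ) = Real.exp (Real.log 2) := (Real.exp_log (by norm_num)).symm
      _ ≤ _ := Real.exp_le_exp.2 (by linarith [Real.log_two_lt_d9])
  have hmgf : mgf (∑ i, fun ω => X i ω ^ 2) P (1 / 8) ≤ Real.exp (7 / 20 * M : ℝ) := by
    rw [hsum]
    calc ∏ i, mgf (fun ω => X i ω ^ 2) P (1 / 8) ≤ ∏ _i : Fin M, Real.exp (7 / 20) :=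
          Finset.prod_le_prod (fun i _ => mgf_nonneg) fun i _ =>
            (hsub i).integral_exp_sq_le.2.trans hsqrt
      _ = Real.exp (7 / 20 * M : ℝ) := by
          rw [Finset.prod_const, Finset.card_univ, Fintype.card_fin, ← Real.exp_nat_mul]
          ring_nf
  have hint : Integrable (fun ω => Real.exp (1 / 8 * (∑ i, fun ω => X i ω ^ 2) ω)) P := by
    rw [← mgf_pos_iff, hsum]
    exact Finset.prod_pos fun i _ => mgf_pos (hsub i).integral_exp_sq_le.1
  have h := measure_ge_le_exp_mul_mgf (μ := P) (4 * M : ℝ) (by norm_num) hint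
  simp only [Finset.sum_apply] at h
  refine h.trans ((mul_le_mul_of_nonneg_left hmgf (Real.exp_pos _).le).trans ?_)
  rw [← Real.exp_add]
  apply le_of_eq
  ring_nf

/-- A matrix with independent subgaussian sub-isotropic rows is bounded below on the vectors with
`‖v‖₁ ≤ 2 L ‖v‖₂`, with high probability. -/
theorem measureReal_exists_norm_rowMap_lt_le {Ω : Type*} [MeasurableSpace Ω] {P : Measure Ω}
    [IsProbabilityMeasure P] {M n k : ℕ} (hM : 0 < M) {d : Fin M → Ω → EuclideanSpace ℝ (Fin n)}
    (hind : iIndepFun d P)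
    (hsub : ∀ v : EuclideanSpace ℝ (Fin n), ‖v‖ = 1 → ∀ i,
      HasSubgaussianMGF (fun ω => inner ℝ (d i ω) v) 2 P)
    (hiso : ∀ v : EuclideanSpace ℝ (Fin n), ‖v‖ = 1 → ∀ i,
      1 ≤ ∫ ω, inner ℝ (d i ω) v ^ 2 ∂P)
    {L : ℝ} (hL : 0 < L) (hk : 625 * L ^ 2 ≤ k) :
    P.real {ω | ∃ v : EuclideanSpace ℝ (Fin n), ∑ j, |v j| ≤ 2 * L * ‖v‖ ∧
        ‖rowMap (fun i => d i ω) v‖ < 3 / 125 * Real.sqrt M * ‖v‖}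
      ≤ Fintype.card (Sym (Fin n × Bool) k) * Real.exp (-(M / 25 : ℝ))
        + n * Real.exp (-(3 / 20 * M : ℝ)) := by
  have hM' : (0 : ℝ) < M := by exact_mod_cast hM
  have hindv : ∀ v : EuclideanSpace ℝ (Fin n), iIndepFun (fun i ω => inner ℝ (d i ω) v) P :=
    fun v => hind.comp (fun _ x => inner ℝ x v) fun _ => by fun_prop
  let y : Sym (Fin n × Bool) k → EuclideanSpace ℝ (Fin n) :=
    fun σ => ((σ : Multiset (Fin n × Bool)).map signedBasis).sum
  let U : Sym (Fin n × Bool) k → Set Ω :=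
    fun σ => {ω | ‖rowMap (fun i => d i ω) (y σ)‖ ^ 2 < M / 25 * ‖y σ‖ ^ 2}
  let V : Fin n → Set Ω := fun j => {ω | 4 * (M : ℝ) < ∑ i, d i ω j ^ 2}
  have hU : ∀ σ, P.real (U σ) ≤ Real.exp (-(M / 25 : ℝ)) := by
    intro σ
    -- Opposite signed basis vectors may cancel; the strict inequality defining `U σ` is then
    -- impossible.
    by_cases h0 : y σ = 0
    · have : U σ = ∅ := by
        ext ω
        simp [U, h0]
      rw [this]
      simpa using (Real.exp_pos _).le
    have hpos : 0 < ‖y σ‖ := norm_pos_iff.2 h0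
    set u := ‖y σ‖⁻¹ • y σ with hu
    have hu1 : ‖u‖ = 1 := by
      rw [hu, norm_smul, norm_inv, norm_norm, inv_mul_cancel₀ hpos.ne']
    refine le_trans (measureReal_mono ?_)
      (measureReal_sum_sq_le_le (hindv u) (hsub u hu1) (hiso u hu1))
    intro ω hω
    simp only [U, Set.mem_ofPred_eq] at hω ⊢
    rw [← norm_rowMap_sq (fun i => d i ω), hu, map_smul, norm_smul, norm_inv, norm_norm, mul_pow,
      inv_pow, inv_mul_le_iff₀ (by positivity)]
    linarith
  have hV : ∀ j, P.real (V j) ≤ Real.exp (-(3 / 20 * M : ℝ)) := by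
    intro j
    have he : ∀ x : EuclideanSpace ℝ (Fin n), inner ℝ x (EuclideanSpace.single j (1 : ℝ)) = x j := by
      intro x
      simp [EuclideanSpace.inner_single_right]
    refine le_trans (measureReal_mono ?_) (measureReal_le_sum_sq_le
      (hindv (EuclideanSpace.single j 1)) (hsub (EuclideanSpace.single j 1) (by simp)))
    intro ω hω
    simp only [V, Set.mem_ofPred_eq, he] at hω ⊢
    exact hω.le
  have hsubset : {ω | ∃ v : EuclideanSpace ℝ (Fin n), ∑ j, |v j| ≤ 2 * L * ‖v‖ ∧
        ‖rowMap (fun i => d i ω) v‖ < 3 / 125 * Real.sqrt M * ‖v‖}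
      ⊆ (⋃ σ, U σ) ∪ ⋃ j, V j := by
    rintro ω ⟨v, hv, hlt⟩
    by_contra hcon
    simp only [Set.mem_union, Set.mem_iUnion, not_or, not_exists, U, V, Set.mem_ofPred_eq,
      not_lt] at hcon
    exact absurd (norm_rowMap_ge hM (fun i => d i ω) hL hk hcon.2 hcon.1 v hv) (not_le.2 hlt)
  refine (measureReal_mono hsubset).trans ((measureReal_union_le _ _).trans (add_le_add ?_ ?_))
  · refine (measureReal_iUnion_fintype_le _).trans
      ((Finset.sum_le_sum fun σ _ => hU σ).trans (le_of_eq ?_))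
    rw [Finset.sum_const, Finset.card_univ, nsmul_eq_mul]
  · refine (measureReal_iUnion_fintype_le _).trans
      ((Finset.sum_le_sum fun j _ => hV j).trans (le_of_eq ?_))
    rw [Finset.sum_const, Finset.card_univ, nsmul_eq_mul, Fintype.card_fin]

/-- Both the net and `n` have size at most `exp (M/200)`, as `626 / 384² < 1/200`. The slack left in
the exponents beyond `M/32` exceeds `1` because `M ≥ 4 · 384²`, so each term is at most half the
bound. -/
theorem card_sym_mul_exp_add_le {M n s k : ℕ} (hs : 1 ≤ s) (hsn : s ≤ n) {L : ℝ}
    (hsL : (s : ℝ) ≤ L ^ 2) (hk1 : 625 * L ^ 2 ≤ k) (hk2 : (k : ℝ) ≤ 626 * L ^ 2)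
    (hM : 384 ^ 2 * L ^ 2 * (2 + Real.sqrt (Real.log (Real.exp 1 * n / s))) ^ 2 ≤ M) :
    Fintype.card (Sym (Fin n × Bool) k) * Real.exp (-(M / 25 : ℝ))
        + n * Real.exp (-(3 / 20 * M : ℝ)) ≤ Real.exp (-(M / 32 : ℝ)) := by
  have hs' : (1 : ℝ) ≤ s := by exact_mod_cast hs
  have hsn' : (s : ℝ) ≤ n := by exact_mod_cast hsn
  have hs0 : (0 : ℝ) < s := by linarith
  have hn0 : (0 : ℝ) < n := by linarith
  have hL1 : 1 ≤ L ^ 2 := hs'.trans hsL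
  have hk0 : (0 : ℝ) < k := by linarith
  set l := Real.log (Real.exp 1 * n / s) with hl
  have hlog : l = 1 + Real.log (n / s) := by
    rw [hl, mul_div_assoc, Real.log_mul (Real.exp_pos 1).ne' (by positivity), Real.log_exp]
  have hlog0 : 0 ≤ Real.log (n / s) := Real.log_nonneg ((one_le_div hs0).2 hsn')
  have hl0 : 0 ≤ l := by linarith
  have hT : L ^ 2 * (4 + l) ≤ M / 147456 := by
    have h1 : 4 + l ≤ (2 + Real.sqrt l) ^ 2 := by
      nlinarith [Real.sq_sqrt hl0, Real.sqrt_nonneg l]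
    have h2 : L ^ 2 * (4 + l) ≤ L ^ 2 * (2 + Real.sqrt l) ^ 2 := by gcongr
    linarith
  have hMlarge : 4 * 147456 ≤ (M : ℝ) := by nlinarith
  have hcard : (Fintype.card (Sym (Fin n × Bool) k) : ℝ) ≤ Real.exp (M / 200) := by
    refine (card_sym_le_exp (by exact_mod_cast hk0)).trans (Real.exp_le_exp.2 ?_)
    have hc : ((Fintype.card (Fin n × Bool) : ℕ) : ℝ) = 2 * n := by
      rw [Fintype.card_prod, Fintype.card_fin, Fintype.card_bool]
      push_cast
      ring
    rw [hc]
    have hle : (2 * n + k : ℝ) / k ≤ 3 * (n / s) := by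
      rw [div_le_iff₀ hk0]
      have hsk : (s : ℝ) ≤ k := by linarith
      have h1 : (k : ℝ) ≤ n / s * k := by
        have := (one_le_div hs0).2 hsn'
        nlinarith
      have h2 : (n : ℝ) ≤ n / s * k := by
        rw [div_mul_eq_mul_div, le_div_iff₀ hs0]
        gcongr
      linarith
    have hlog3 : Real.log ((2 * n + k : ℝ) / k) ≤ 2 + Real.log (n / s) := by
      refine (Real.log_le_log (by positivity) hle).trans ?_
      rw [Real.log_mul (by norm_num) (by positivity)]
      linarith [Real.log_le_sub_one_of_pos (show (0 : ℝ) < 3 by norm_num)]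
    calc (k : ℝ) * (1 + Real.log ((2 * n + k : ℝ) / k)) ≤ k * (4 + l) :=
          mul_le_mul_of_nonneg_left (by linarith) hk0.le
      _ ≤ 626 * L ^ 2 * (4 + l) := mul_le_mul_of_nonneg_right hk2 (by linarith)
      _ ≤ M / 200 := by linarith
  have hnle : (n : ℝ) ≤ Real.exp (M / 200) := by
    have h1 : (n : ℝ) = s * (n / s) := by field_simp
    have h2 : (s : ℝ) ≤ Real.exp s := by linarith [Real.add_one_le_exp (s : ℝ)]
    calc (n : ℝ) = s * Real.exp (Real.log (n / s)) := by
          rw [Real.exp_log (by positivity), ← h1]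
      _ ≤ Real.exp s * Real.exp (Real.log (n / s)) := by gcongr
      _ = Real.exp (s + Real.log (n / s)) := (Real.exp_add _ _).symm
      _ ≤ Real.exp (M / 200) := Real.exp_le_exp.2 (by nlinarith)
  have hA : Fintype.card (Sym (Fin n × Bool) k) * Real.exp (-(M / 25 : ℝ))
      ≤ Real.exp (-(M / 32) + -1) := by
    refine (mul_le_mul_of_nonneg_right hcard (Real.exp_pos _).le).trans ?_
    rw [← Real.exp_add, Real.exp_le_exp]
    linarith
  have hB : n * Real.exp (-(3 / 20 * M : ℝ)) ≤ Real.exp (-(M / 32) + -1) := by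
    refine (mul_le_mul_of_nonneg_right hnle (Real.exp_pos _).le).trans ?_
    rw [← Real.exp_add, Real.exp_le_exp]
    linarith
  rw [Real.exp_add] at hA hB
  have he : Real.exp (-1) ≤ 1 / 2 := by
    rw [Real.exp_neg, inv_le_comm₀ (Real.exp_pos _) (by norm_num)]
    linarith [Real.add_one_le_exp (1 : ℝ)]
  nlinarith [Real.exp_pos (-(M / 32 : ℝ))]

/-! ### From the cone bound to the null space property -/

theorem lqNorm_one {ι : Type*} [Fintype ι] (x : ι → ℝ) : lqNorm 1 x = ∑ i, |x i| := by
  simp [lqNorm]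

theorem lqNorm_nonneg {ι : Type*} [Fintype ι] (q : ℝ) (x : ι → ℝ) : 0 ≤ lqNorm q x :=
  Real.rpow_nonneg (Finset.sum_nonneg fun _ _ => Real.rpow_nonneg (abs_nonneg _) q) _

theorem lqNorm_two {ι : Type*} [Fintype ι] (x : ι → ℝ) :
    lqNorm 2 x = Real.sqrt (∑ i, x i ^ 2) := by
  simp only [lqNorm, Real.rpow_two, sq_abs, Real.sqrt_eq_rpow]

/-- Each entry is at most `N = ‖x‖₂`, hence `∑ |x i| ^ q ≤ N ^ (q - 2) ∑ x i ² = N ^ q`. -/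
theorem lqNorm_le_lqNorm_two {ι : Type*} [Fintype ι] {q : ℝ} (hq : 2 ≤ q) (x : ι → ℝ) :
    lqNorm q x ≤ lqNorm 2 x := by
  set N := lqNorm 2 x with hN
  have hN0 : 0 ≤ N := lqNorm_nonneg 2 x
  have hN2 : N ^ 2 = ∑ i, x i ^ 2 := by
    rw [hN, lqNorm_two, Real.sq_sqrt (Finset.sum_nonneg fun i _ => sq_nonneg _)]
  have hle : ∀ i, |x i| ≤ N := fun i => by
    refine abs_le_of_sq_le_sq ?_ hN0
    rw [hN2]
    exact Finset.single_le_sum (f := fun i => x i ^ 2) (fun j _ => sq_nonneg _) (Finset.mem_univ i)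
  have hsplit : ∀ t : ℝ, 0 ≤ t → t ^ q = t ^ (q - 2) * t ^ 2 := by
    intro t ht
    rw [← Real.rpow_two, ← Real.rpow_add' ht (by linarith), sub_add_cancel]
  have hsum : ∑ i, |x i| ^ q ≤ N ^ q := by
    rw [hsplit N hN0, hN2, Finset.mul_sum]
    refine Finset.sum_le_sum fun i _ => ?_
    rw [hsplit _ (abs_nonneg _), sq_abs]
    exact mul_le_mul_of_nonneg_right
      (Real.rpow_le_rpow (abs_nonneg _) (hle i) (by linarith)) (sq_nonneg _)
  calc lqNorm q x ≤ (N ^ q) ^ (1 / q) :=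
        Real.rpow_le_rpow (Finset.sum_nonneg fun i _ => Real.rpow_nonneg (abs_nonneg _) q) hsum
          (by positivity)
    _ = N := by rw [← Real.rpow_mul hN0, mul_one_div_cancel (by linarith), Real.rpow_one]

/-- A lower bound on the vectors with `‖v‖₁ ≤ 2 L ‖v‖₂`, where `L = s ^ (1 - 1/q) / ρ`, implies
the robust null space property. -/
theorem robustNSP_of_lower_bound {m n s : ℕ} (hs : 1 ≤ s) {q ρ τ : ℝ} (hq : 2 ≤ q) (hρ0 : 0 < ρ)
    (hρ1 : ρ < 1) (hτ : 0 < τ) {A : Matrix (Fin m) (Fin n) ℝ}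
    (h : ∀ v : EuclideanSpace ℝ (Fin n),
      ∑ j, |v j| ≤ 2 * ((s : ℝ) ^ (1 - 1 / q) / ρ) * ‖v‖ → ‖v‖ ≤ τ * lqNorm 2 (A.mulVec v)) :
    RobustNSP q s ρ τ A := by
  intro v S hS
  have hs' : (1 : ℝ) ≤ s := by exact_mod_cast hs
  have hp : 0 < (s : ℝ) ^ (1 - 1 / q) := Real.rpow_pos_of_pos (by linarith) _
  set L := (s : ℝ) ^ (1 - 1 / q) / ρ with hLdef
  have hL0 : 0 < L := by positivity
  have hLinv : ρ / (s : ℝ) ^ (1 - 1 / q) = L⁻¹ := by rw [hLdef, inv_div]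
  have hsL : Real.sqrt s ≤ L := by
    have h1 : Real.sqrt s ≤ (s : ℝ) ^ (1 - 1 / q) := by
      rw [Real.sqrt_eq_rpow]
      refine Real.rpow_le_rpow_of_exponent_le hs' ?_
      have : 1 / q ≤ 1 / 2 := by gcongr
      linarith
    exact h1.trans (le_div_self hp.le hρ0 hρ1.le)
  rw [hLinv]
  set x := lqNorm q (Set.indicator (S : Set (Fin n)) v) with hx
  set y := lqNorm 1 (Set.indicator (S : Set (Fin n))ᶜ v) with hy
  have hA0 : 0 ≤ τ * lqNorm 2 (A.mulVec v) := mul_nonneg hτ.le (lqNorm_nonneg _ _)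
  -- Otherwise `‖v_{Sᶜ}‖₁ ≤ L ‖v_S‖_q ≤ L ‖v‖₂`, while `‖v_S‖₁ ≤ √s ‖v‖₂ ≤ L ‖v‖₂`: the vector lies
  -- in the cone.
  by_cases hxy : x ≤ L⁻¹ * y
  · linarith
  push Not at hxy
  have hyx : y ≤ L * x := by
    rw [inv_mul_lt_iff₀ hL0] at hxy
    exact hxy.le
  set u : EuclideanSpace ℝ (Fin n) := WithLp.toLp 2 v with hu
  have hun : ‖u‖ = Real.sqrt (∑ j, v j ^ 2) := by
    rw [EuclideanSpace.norm_eq]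
    simp [hu]
  set z := lqNorm 2 (Set.indicator (S : Set (Fin n)) v) with hz
  have hxz : x ≤ z := lqNorm_le_lqNorm_two hq _
  have hz2 : z = Real.sqrt (∑ j ∈ S, v j ^ 2) := by
    rw [hz, lqNorm_two]
    congr 1
    rw [← Finset.sum_indicator_subset (fun j => v j ^ 2) (Finset.subset_univ S)]
    refine Finset.sum_congr rfl fun j _ => ?_
    by_cases hj : j ∈ S <;> simp [hj]
  have hzu : z ≤ ‖u‖ := by
    rw [hz2, hun]
    exact Real.sqrt_le_sqrt (Finset.sum_le_sum_of_subset_of_nonneg (Finset.subset_univ S)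
      fun _ _ _ => sq_nonneg _)
  have hS1 : ∑ j ∈ S, |v j| ≤ Real.sqrt s * z := by
    rw [hz2, ← Real.sqrt_mul (by linarith)]
    refine Real.le_sqrt_of_sq_le ?_
    refine sq_sum_le_card_mul_sum_sq.trans ?_
    simp_rw [sq_abs]
    have : (S.card : ℝ) ≤ s := by exact_mod_cast hS
    gcongr
  have hsum : ∑ j, |u j| = ∑ j ∈ S, |v j| + y := by
    rw [hy, lqNorm_one, ← Finset.sum_indicator_subset (fun j => |v j|) (Finset.subset_univ S),
      ← Finset.sum_add_distrib]
    refine Finset.sum_congr rfl fun j _ => ?_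
    by_cases hj : j ∈ S <;> simp [hj, hu]
  have hcone : ∑ j, |u j| ≤ 2 * L * ‖u‖ := by
    have h1 : Real.sqrt s * z ≤ L * ‖u‖ := mul_le_mul hsL hzu (lqNorm_nonneg _ _) hL0.le
    have h2 : L * x ≤ L * ‖u‖ := mul_le_mul_of_nonneg_left (hxz.trans hzu) hL0.le
    linarith
  have hfin : ‖u‖ ≤ τ * lqNorm 2 (A.mulVec v) := h u hcone
  have : 0 ≤ L⁻¹ * y := mul_nonneg (inv_pos.2 hL0).le (lqNorm_nonneg _ _)
  linarith

/-! ### Differences of paired rows -/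

/-- Grouping an independent family indexed by a product gives independent tuples. -/
theorem iIndepFun.curry {Ω ι κ β : Type*} [MeasurableSpace Ω] [Countable ι] [Countable κ]
    [MeasurableSpace β] {P : Measure Ω} {X : ι × κ → Ω → β} (hX : ∀ p, AEMeasurable (X p) P)
    (h : iIndepFun X P) : iIndepFun (fun i ω j => X (i, j) ω) P := by
  have := h.isProbabilityMeasure
  have hP : ∀ p, IsProbabilityMeasure (P.map (X p)) := fun p =>
    Measure.isProbabilityMeasure_map (hX p)
  rw [iIndepFun_iff_map_fun_eq_infinitePi_map₀'
    (fun i => aemeasurable_pi_lambda _ fun j => hX (i, j))]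
  have h1 : ∀ i, P.map (fun ω j => X (i, j) ω)
      = Measure.infinitePi fun j => P.map (X (i, j)) := fun i =>
    (h.precomp (g := fun j => (i, j)) (fun j j' hj => (Prod.mk.inj hj).2)
      ).map_fun_eq_infinitePi_map₀' fun j => hX (i, j)
  simp_rw [h1]
  have hσ : iIndepFun (fun p : (_ : ι) × κ => X (p.1, p.2)) P :=
    h.precomp (g := Equiv.sigmaEquivProd ι κ) (Equiv.sigmaEquivProd ι κ).injective
  have h2 := hσ.map_fun_eq_infinitePi_map₀' fun p : (_ : ι) × κ => hX (p.1, p.2)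
  have h3 := Measure.infinitePi_map_piCurry (fun i j => P.map (X (i, j)))
  rw [← h3, ← h2, AEMeasurable.map_map_of_aemeasurable
    (MeasurableEquiv.measurable _).aemeasurable
    (aemeasurable_pi_lambda _ fun p : (_ : ι) × κ => hX (p.1, p.2))]
  rfl

/-- The index `2 i + b`. -/
def pairIndex {m : ℕ} (p : Fin (m / 2) × Fin 2) : Fin m :=
  ⟨2 * p.1 + p.2, by omega⟩

theorem pairIndex_injective {m : ℕ} : Function.Injective (pairIndex (m := m)) := by
  rintro ⟨i, b⟩ ⟨j, c⟩ h
  simp only [pairIndex, Fin.mk.injEq] at h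
  ext <;> simp only <;> omega

/-- The normalized differences of consecutive rows. -/
noncomputable def pairDiff {m n : ℕ} (a : Fin m → EuclideanSpace ℝ (Fin n)) (i : Fin (m / 2)) :
    EuclideanSpace ℝ (Fin n) :=
  (Real.sqrt 2)⁻¹ • (a (pairIndex (i, 0)) - a (pairIndex (i, 1)))

theorem inner_pairDiff {m n : ℕ} (a : Fin m → EuclideanSpace ℝ (Fin n)) (i : Fin (m / 2))
    (v : EuclideanSpace ℝ (Fin n)) : inner ℝ (pairDiff a i) v = (Real.sqrt 2)⁻¹ *
      (inner ℝ (a (pairIndex (i, 0))) v - inner ℝ (a (pairIndex (i, 1))) v) := by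
  rw [pairDiff, real_inner_smul_left, inner_sub_left]

/-- Passing to differences of rows removes the bias and does not increase the norm. -/
theorem norm_rowMap_pairDiff_le {m n : ℕ} (a : Fin m → EuclideanSpace ℝ (Fin n)) (μ : ℝ)
    (v : EuclideanSpace ℝ (Fin n)) :
    ‖rowMap (pairDiff a) v‖ ≤ lqNorm 2 ((biasedMatrix a μ).mulVec v) := by
  rw [lqNorm_two]
  refine Real.le_sqrt_of_sq_le ?_
  rw [norm_rowMap_sq]
  have hrow : ∀ j, (biasedMatrix a μ).mulVec v j = inner ℝ (a j) v + μ * ∑ l, v l := by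
    intro j
    rw [PiLp.inner_apply, Finset.mul_sum, ← Finset.sum_add_distrib, Matrix.mulVec, dotProduct]
    refine Finset.sum_congr rfl fun l _ => ?_
    simp [biasedMatrix]
    ring
  simp_rw [hrow]
  have hsq : (Real.sqrt 2)⁻¹ ^ 2 = 1 / 2 := by
    rw [inv_pow, Real.sq_sqrt (by norm_num)]
    norm_num
  calc ∑ i, inner ℝ (pairDiff a i) v ^ 2
      ≤ ∑ i, ∑ b : Fin 2, (inner ℝ (a (pairIndex (i, b))) v + μ * ∑ l, v l) ^ 2 := by
        refine Finset.sum_le_sum fun i _ => ?_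
        rw [inner_pairDiff, mul_pow, hsq, Fin.sum_univ_two]
        nlinarith [sq_nonneg ((inner ℝ (a (pairIndex (i, 0))) v + μ * ∑ l, v l)
          + (inner ℝ (a (pairIndex (i, 1))) v + μ * ∑ l, v l))]
    _ = ∑ j ∈ Finset.univ.map ⟨pairIndex, pairIndex_injective⟩,
          (inner ℝ (a j) v + μ * ∑ l, v l) ^ 2 := by
        rw [Finset.sum_map, Fintype.sum_prod_type]
        rfl
    _ ≤ _ := Finset.sum_le_sum_of_subset_of_nonneg (Finset.subset_univ _)
        fun _ _ _ => sq_nonneg _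

theorem OneSubgaussian.hasSubgaussianMGF {Ω : Type*} [MeasurableSpace Ω] {P : Measure Ω} {n : ℕ}
    {X : Ω → EuclideanSpace ℝ (Fin n)} (h : OneSubgaussian X P) {v : EuclideanSpace ℝ (Fin n)}
    (hv : ‖v‖ = 1) : HasSubgaussianMGF (fun ω => inner ℝ (X ω) v) 2 P where
  integrable_exp_mul t := (h v (by rw [hv]; norm_num) t).1
  mgf_le t := by
    refine (h v (by rw [hv]; norm_num) t).2.trans (le_of_eq ?_)
    congr 1
    simp only [NNReal.coe_ofNat]
    ring

section Pairs

variable {Ω : Type*} [MeasurableSpace Ω] {P : Measure Ω} {X Y : Ω → ℝ}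

/-- Variance proxies of independent variables add to `2 + 2`, and the scaling halves this. -/
theorem hasSubgaussianMGF_normalized_sub (hX : HasSubgaussianMGF X 2 P)
    (hY : HasSubgaussianMGF Y 2 P) (h : IndepFun X Y P) :
    HasSubgaussianMGF (fun ω => (Real.sqrt 2)⁻¹ * (X ω - Y ω)) 2 P := by
  have h1 := (hX.sub_of_indepFun hY h).const_mul (Real.sqrt 2)⁻¹
  convert h1 using 1
  ext
  have hsq : (Real.sqrt 2)⁻¹ ^ 2 = 1 / 2 := by
    rw [inv_pow, Real.sq_sqrt (by norm_num)]
    norm_num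
  have hcoe : ∀ r : NNReal, (r : ℝ) = 1 / 2 → ((2 : NNReal) : ℝ) = (r * (2 + 2) : NNReal) := by
    intro r hr
    push_cast
    rw [hr]
    norm_num
  exact hcoe _ hsq

/-- The cross term `E XY` vanishes by independence and centring. -/
theorem one_le_integral_normalized_sub_sq [IsProbabilityMeasure P]
    (hX : HasSubgaussianMGF X 2 P) (hY : HasSubgaussianMGF Y 2 P) (h : IndepFun X Y P) (hX1 : 1 ≤ ∫ ω, X ω ^ 2 ∂P)
    (hY1 : 1 ≤ ∫ ω, Y ω ^ 2 ∂P) : 1 ≤ ∫ ω, ((Real.sqrt 2)⁻¹ * (X ω - Y ω)) ^ 2 ∂P := by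
  have hX2 : Integrable (fun ω => X ω ^ 2) P := (hX.memLp 2).integrable_sq
  have hY2 : Integrable (fun ω => Y ω ^ 2) P := (hY.memLp 2).integrable_sq
  have hXY : Integrable (fun ω => X ω * Y ω) P := h.integrable_mul hX.integrable hY.integrable
  have h0 : ∫ ω, X ω * Y ω ∂P = 0 := by
    have := h.integral_mul_eq_mul_integral hX.aestronglyMeasurable hY.aestronglyMeasurable
    rw [hX.integral_eq_zero, zero_mul] at this
    exact this
  have hsq : (Real.sqrt 2)⁻¹ ^ 2 = 1 / 2 := by
    rw [inv_pow, Real.sq_sqrt (by norm_num)]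
    norm_num
  have e : ∀ ω, ((Real.sqrt 2)⁻¹ * (X ω - Y ω)) ^ 2
      = 1 / 2 * (X ω ^ 2 + Y ω ^ 2) - X ω * Y ω := by
    intro ω
    rw [mul_pow, hsq]
    ring
  simp_rw [e]
  have hI : Integrable (fun ω => X ω ^ 2 + Y ω ^ 2) P := hX2.add hY2
  rw [integral_sub (hI.const_mul _) hXY, integral_const_mul, integral_add hX2 hY2, h0]
  linarith

end Pairs

/-! ### Assembly -/

theorem corollary1 (m n s : ℕ) (hs : 1 ≤ s) (hsn : s ≤ n) (q ρ : ℝ) (hq : 2 ≤ q)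
    (hρ0 : 0 < ρ) (hρ1 : ρ < 1)
    (hm : 2 * 384 ^ 2 / ρ ^ 2 * (s : ℝ) ^ (2 - 2 / q)
        * (2 + Real.sqrt (Real.log (Real.exp 1 * (n : ℝ) / (s : ℝ)))) ^ 2 + 1 ≤ (m : ℝ)) :
    ∃ τ : ℝ, 0 < τ ∧
      ∀ (Ω₀ : Type*) [MeasurableSpace Ω₀] (P₀ : Measure Ω₀) [IsProbabilityMeasure P₀]
        (Ω : Type*) [MeasurableSpace Ω] (P : Measure Ω) [IsProbabilityMeasure P]
        (a₀ : Ω₀ → EuclideanSpace ℝ (Fin n)) (a : Fin m → Ω → EuclideanSpace ℝ (Fin n)),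
        SubIsotropic a₀ P₀ → OneSubgaussian a₀ P₀ →
        (∀ i, IdentDistrib (a i) a₀ P P₀) → iIndepFun a P →
        ∀ μ : ℝ,
          1 - Real.exp (-((m : ℝ) - 1) / 64) ≤
            P.real {ω | RobustNSP q s ρ τ (biasedMatrix (fun i => a i ω) μ)} := by
  have hs' : (1 : ℝ) ≤ s := by exact_mod_cast hs
  set L := (s : ℝ) ^ (1 - 1 / q) / ρ with hLdef
  have hp : 0 < (s : ℝ) ^ (1 - 1 / q) := Real.rpow_pos_of_pos (by linarith) _
  have hL0 : 0 < L := by positivity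
  have hL2 : L ^ 2 = (s : ℝ) ^ (2 - 2 / q) / ρ ^ 2 := by
    rw [hLdef, div_pow, ← Real.rpow_natCast, ← Real.rpow_mul (by linarith)]
    congr 2
    push_cast
    ring
  have hsL : (s : ℝ) ≤ L ^ 2 := by
    have h1 : (s : ℝ) ≤ (s : ℝ) ^ (2 - 2 / q) := by
      refine Real.self_le_rpow_of_one_le hs' ?_
      have : 2 / q ≤ 1 := (div_le_one (by linarith)).2 hq
      linarith
    rw [hL2]
    exact h1.trans (le_div_self (by positivity) (by positivity) (by nlinarith))
  set M := m / 2 with hMdef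
  -- For odd `m` the last row is unused; this is the source of `m - 1` in the exponent and of `+ 1`
  -- in the condition on `m`.
  have hMm : (m : ℝ) ≤ 2 * M + 1 := by
    have : m ≤ 2 * (m / 2) + 1 := by omega
    exact_mod_cast this
  have hM : 384 ^ 2 * L ^ 2 * (2 + Real.sqrt (Real.log (Real.exp 1 * n / s))) ^ 2 ≤ M := by
    have e : 2 * 384 ^ 2 / ρ ^ 2 * (s : ℝ) ^ (2 - 2 / q) = 2 * (384 ^ 2 * L ^ 2) := by
      rw [hL2]
      ring
    rw [e] at hm
    linarith
  have hM0 : 0 < M := by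
    have : (0 : ℝ) < M := lt_of_lt_of_le (by positivity) hM
    exact_mod_cast this
  have hMr : (0 : ℝ) < M := by exact_mod_cast hM0
  set k := ⌈625 * L ^ 2⌉₊ with hk
  have hk1 : 625 * L ^ 2 ≤ k := Nat.le_ceil _
  -- Rounding up costs at most `1 ≤ s ≤ L²`.
  have hk2 : (k : ℝ) ≤ 626 * L ^ 2 := by
    have := Nat.ceil_lt_add_one (show 0 ≤ 625 * L ^ 2 by positivity)
    linarith
  refine ⟨125 / (3 * Real.sqrt M), by positivity, ?_⟩
  intro Ω₀ _ P₀ _ Ω _ P _ a₀ a hiso hsub hid hind μ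
  have hmeas : ∀ i, AEMeasurable (a i) P := fun i => (hid i).aemeasurable_fst
  have hidv : ∀ v j, IdentDistrib (fun ω => inner ℝ (a j ω) v) (fun ω => inner ℝ (a₀ ω) v) P P₀ :=
    fun v j => (hid j).comp (u := fun x => inner ℝ x v) (by fun_prop)
  have hsubj : ∀ v : EuclideanSpace ℝ (Fin n), ‖v‖ = 1 → ∀ j,
      HasSubgaussianMGF (fun ω => inner ℝ (a j ω) v) 2 P := fun v hv j =>
    (hsub.hasSubgaussianMGF hv).congr_identDistrib (hidv v j).symm
  have hisoj : ∀ v : EuclideanSpace ℝ (Fin n), ‖v‖ = 1 → ∀ j,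
      1 ≤ ∫ ω, inner ℝ (a j ω) v ^ 2 ∂P := by
    intro v hv j
    have h1 := (hiso v).2
    rw [hv, one_pow] at h1
    exact h1.trans (le_of_eq ((hidv v j).sq.integral_eq).symm)
  have hindv : ∀ v i, IndepFun (fun ω => inner ℝ (a (pairIndex (i, 0)) ω) v)
      (fun ω => inner ℝ (a (pairIndex (i, 1)) ω) v) P := by
    intro v i
    have hne : pairIndex (m := m) (i, 0) ≠ pairIndex (i, 1) := fun h => by
      simpa using pairIndex_injective h
    exact (hind.indepFun hne).comp (φ := fun x => inner ℝ x v) (ψ := fun x => inner ℝ x v)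
      (by fun_prop) (by fun_prop)
  have hindd : iIndepFun (fun (i : Fin (m / 2)) ω => pairDiff (fun j => a j ω) i) P := by
    have h1 := iIndepFun.curry (fun p => hmeas (pairIndex p)) (hind.precomp pairIndex_injective)
    exact h1.comp (fun _ x => (Real.sqrt 2)⁻¹ • (x 0 - x 1)) fun _ => by fun_prop
  have hbad := (measureReal_exists_norm_rowMap_lt_le hM0 hindd
    (fun v hv i => by
      simp_rw [inner_pairDiff]
      exact hasSubgaussianMGF_normalized_sub (hsubj v hv _) (hsubj v hv _) (hindv v i))
    (fun v hv i => by
      simp_rw [inner_pairDiff]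
      exact one_le_integral_normalized_sub_sq (hsubj v hv _) (hsubj v hv _) (hindv v i)
        (hisoj v hv _) (hisoj v hv _)) hL0 hk1).trans
    (card_sym_mul_exp_add_le hs hsn hsL hk1 hk2 hM)
  set bad := {ω | ∃ v : EuclideanSpace ℝ (Fin n), ∑ j, |v j| ≤ 2 * L * ‖v‖ ∧
    ‖rowMap (fun i => pairDiff (fun j => a j ω) i) v‖ < 3 / 125 * Real.sqrt M * ‖v‖} with hbaddef
  set good := {ω | RobustNSP q s ρ (125 / (3 * Real.sqrt M)) (biasedMatrix (fun i => a i ω) μ)}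
  -- Subadditivity on a cover avoids any measurability claim about `good` or `bad`.
  have hcover : Set.univ ⊆ bad ∪ good := by
    intro ω _
    by_cases hω : ω ∈ bad
    · exact Or.inl hω
    refine Or.inr (robustNSP_of_lower_bound hs hq hρ0 hρ1 (by positivity) fun v hv => ?_)
    simp only [hbaddef, Set.mem_ofPred_eq, not_exists, not_and, not_lt] at hω
    have h1 := (hω v hv).trans (norm_rowMap_pairDiff_le (fun j => a j ω) μ v)
    rw [div_mul_eq_mul_div, le_div_iff₀ (by positivity)]
    linarith
  have htot : 1 ≤ P.real bad + P.real good := by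
    have := (measureReal_mono (μ := P) hcover).trans (measureReal_union_le _ _)
    rwa [probReal_univ] at this
  have hexp : Real.exp (-(M / 32 : ℝ)) ≤ Real.exp (-((m : ℝ) - 1) / 64) :=
    Real.exp_le_exp.2 (by linarith)
  linarith
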